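/- An overpartition of a nonnegative integer $n$ is a partition of $n$ in which the first occurrence of each distinct part may be overlined. Let $\overline{S}_o(n)$ (respectively $\overline{S}_e(n)$) denote the sum of all odd (respectively even) parts, overlined or not and counted with multiplicity, taken over all overpartitions of $n$. Then for every integer $n \ge 0$, $$\overline{S}_o(4n+3) \equiv \overline{S}_e(4n+3) \equiv 0 \pmod{8},$$ $$\overline{S}_o(8n+7) \equiv \overline{S}_e(8n+7) \equiv 0 \pmod{64}.$$ -/

import Mathlib

/-- An overpartition of `n`: a partition of `n` in which the first occurrence of each distinct
part may be overlined. It is recorded as the underlying partition together with the set of those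
part sizes whose first occurrence is overlined. -/
@[ext]
structure Overpartition (n : ℕ) where
  /-- the underlying partition -/
  toPartition : n.Partition
  /-- the part sizes whose first occurrence is overlined -/
  overlined : Finset ℕ
  /-- only parts that occur can be overlined -/
  overlined_subset : overlined ⊆ toPartition.parts.toFinset

namespace Overpartition

/-- The overpartitions of `n` as pairs of a partition and a subset of its set of part sizes. -/
def equivSigma (n : ℕ) :
    Overpartition n ≃ Σ p : n.Partition, {s : Finset ℕ // s ∈ p.parts.toFinset.powerset} where
  toFun a := ⟨a.toPartition, a.overlined, Finset.mem_powerset.2 a.overlined_subset⟩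
  invFun x := ⟨x.1, x.2.1, Finset.mem_powerset.1 x.2.2⟩
  left_inv _ := rfl
  right_inv _ := rfl

instance instFintype (n : ℕ) : Fintype (Overpartition n) :=
  Fintype.ofEquiv _ (equivSigma n).symm

/-- The multiset of all parts of an overpartition, overlined or not, as positive integers. -/
def parts {n : ℕ} (a : Overpartition n) : Multiset ℕ := a.toPartition.parts

/-- The sum of all odd parts (with multiplicity) over all overpartitions of `n`. -/
def oddPartsSum (n : ℕ) : ℕ := ∑ a : Overpartition n, (a.parts.filter Odd).sum

/-- The sum of all even parts (with multiplicity) over all overpartitions of `n`. -/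
def evenPartsSum (n : ℕ) : ℕ := ∑ a : Overpartition n, (a.parts.filter Even).sum

end Overpartition

open PowerSeries Filter Topology
open scoped PowerSeries.WithPiTopology

/-! Let `P(q)` be the overpartition generating function, `O(q)` its odd-part factor, and `φ(q)` the
theta series. Gauss's identity says `P(q) φ(-q) = 1`. Since `P(q) = O(q) P(q²)` and `O(q) O(-q) =
1`, also `P(q) P(-q) = P(q²)²`, whence `P = φ · P(q²)²` and `O = φ · P(q²)`. Marking even parts by
`z` and differentiating at `z = 1` gives the series of even-part sums as `O · θ(P(q²)) = φ ·
θ(P(q²)²) / 2`, with `θ = q d/dq`. So the even-part sum and the number of overpartitions are both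
controlled by the products `[q^a] φ · [q^b] P(q²)²` with `a + b = n`; `dvd_coeff_thetaSeries_mul`
bounds their 2-adic size. The odd-part sum follows, as both sums add up to `n` times the number of
overpartitions. -/

/-! ### Gauss's identity for the theta series -/

theorem gauss_telescoping {R : Type*} [CommRing R] (q : R) (n m : ℕ) (hm : m ≤ n) :
    ∏ i ∈ Finset.Ioc 0 (n + 1), (1 - q ^ i) - (1 + q ^ (n + 1)) * ∏ i ∈ Finset.Ioc 0 n, (1 - q ^ i) +
      2 * ∑ s ∈ Finset.range m, (-1) ^ (s + 1) * (∏ i ∈ Finset.Ioc 0 s, (1 + q ^ i)) *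
        (q ^ ((s + 1) * (n + 2)) * ∏ i ∈ Finset.Ioc (s + 1) (n + 1), (1 - q ^ i) -
          (1 + q ^ (n + 1)) * q ^ ((s + 1) * (n + 1)) * ∏ i ∈ Finset.Ioc (s + 1) n, (1 - q ^ i)) =
    -2 * (-1) ^ m * q ^ ((m + 1) * (n + 1)) * (∏ i ∈ Finset.Ioc 0 m, (1 + q ^ i)) *
      ∏ i ∈ Finset.Ioc m n, (1 - q ^ i) := by
  induction m with
  | zero =>
    rw [Finset.prod_Ioc_succ_top (by omega)]
    simp
    ring
  | succ m ih =>
    rw [Finset.sum_range_succ, mul_add, ← add_assoc, ih (by omega),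
      Finset.prod_Ioc_succ_top (b := m) (by omega),
      Finset.prod_Ioc_succ_top (a := m + 1) (b := n) (by omega),
      ← Finset.prod_Ioc_consecutive _ (Nat.le_succ m) hm]
    simp
    ring

/-- A finite form of Gauss's identity `1 + 2 ∑ (-1)^k q^(k^2) = ∏ (1 - q^i) / (1 + q^i)`. -/
theorem gauss_finite {R : Type*} [CommRing R] (q : R) (n : ℕ) :
    (∏ i ∈ Finset.Ioc 0 n, (1 + q ^ i)) *
      (1 + 2 * ∑ j ∈ Finset.range n, (-1) ^ (j + 1) * q ^ ((j + 1) ^ 2)) =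
    ∏ i ∈ Finset.Ioc 0 n, (1 - q ^ i) +
      2 * ∑ s ∈ Finset.range n, (-1) ^ (s + 1) * (∏ i ∈ Finset.Ioc 0 s, (1 + q ^ i)) *
        (q ^ ((s + 1) * (n + 1)) * ∏ i ∈ Finset.Ioc (s + 1) n, (1 - q ^ i)) := by
  induction n with
  | zero => simp
  | succ n ih =>
    -- The defect between the right side at `n + 1` and `1 + q ^ (n + 1)` times the right side at
    -- `n`, the new summand `s = n` aside, telescopes to a multiple of `q ^ ((n + 1) ^ 2)`, the new
    -- theta term.
    have h := gauss_telescoping q n n le_rfl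
    simp only [mul_sub, Finset.sum_sub_distrib] at h
    have e : ∑ s ∈ Finset.range n, (-1) ^ (s + 1) * (∏ i ∈ Finset.Ioc 0 s, (1 + q ^ i)) *
          ((1 + q ^ (n + 1)) * q ^ ((s + 1) * (n + 1)) * ∏ i ∈ Finset.Ioc (s + 1) n, (1 - q ^ i)) =
        (1 + q ^ (n + 1)) *
          ∑ s ∈ Finset.range n, (-1) ^ (s + 1) * (∏ i ∈ Finset.Ioc 0 s, (1 + q ^ i)) *
            (q ^ ((s + 1) * (n + 1)) * ∏ i ∈ Finset.Ioc (s + 1) n, (1 - q ^ i)) := by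
      rw [Finset.mul_sum]
      exact Finset.sum_congr rfl fun _ _ => by ring
    rw [e] at h
    rw [Finset.sum_range_succ, Finset.sum_range_succ, Finset.prod_Ioc_succ_top (b := n) (by omega)]
    simp only [Finset.Ioc_self, Finset.prod_empty] at h ⊢
    linear_combination (1 + q ^ (n + 1)) * ih - h

/-- The theta series `∑ X ^ (k ^ 2)` over all integers `k`. -/
noncomputable def thetaSeries : ℤ⟦X⟧ :=
  PowerSeries.mk fun n => if n = 0 then 1 else if IsSquare n then 2 else 0

theorem coeff_rescale_thetaSeries {d n : ℕ} (h : d ≤ n) :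
    coeff d (rescale (-1) thetaSeries) =
      coeff d (1 + 2 * ∑ j ∈ Finset.range n, (-1) ^ (j + 1) * (X : ℤ⟦X⟧) ^ ((j + 1) ^ 2)) := by
  have hc (j : ℕ) : coeff d ((-1) ^ (j + 1) * (X : ℤ⟦X⟧) ^ ((j + 1) ^ 2)) =
      if d = (j + 1) ^ 2 then (-1) ^ (j + 1) else 0 := by
    rw [show ((-1 : ℤ⟦X⟧) ^ (j + 1)) = C ((-1) ^ (j + 1)) by simp, coeff_C_mul, coeff_X_pow]
    simp
  rw [coeff_rescale, thetaSeries, coeff_mk, map_add, show (2 : ℤ⟦X⟧) = C 2 by simp, coeff_C_mul,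
    map_sum, coeff_one]
  simp only [hc]
  rcases Nat.eq_zero_or_pos d with rfl | hd
  · simp [Finset.sum_eq_zero, eq_comm (a := 0)]
  rw [if_neg hd.ne', if_neg hd.ne']
  split_ifs with hs
  · obtain ⟨k, rfl⟩ := hs
    have hk : 0 < k := by by_contra h0; simp_all
    obtain ⟨k, rfl⟩ := Nat.exists_eq_add_one_of_ne_zero hk.ne'
    rw [Finset.sum_eq_single k]
    · rw [if_pos (by ring), pow_mul, mul_comm, zero_add]
      congr 1
      rcases Nat.even_or_odd (k + 1) with h' | h' <;> simp [h'.neg_one_pow]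
    · intro b _ hb
      rw [if_neg]
      intro e
      apply hb
      rw [← pow_two] at e
      have := Nat.pow_left_injective (n := 2) (by norm_num) e
      omega
    · intro hb
      simp only [Finset.mem_range] at hb
      nlinarith
  · rw [Finset.sum_eq_zero]
    · simp
    · intro j _
      rw [if_neg]
      rintro rfl
      exact hs ⟨j + 1, by ring⟩

theorem prod_Ioc_eq_prod_range {M : Type*} [CommMonoid M] (f : ℕ → M) (n : ℕ) :
    ∏ i ∈ Finset.Ioc 0 n, f i = ∏ i ∈ Finset.range n, f (i + 1) := by
  induction n with
  | zero => simp
  | succ n ih => rw [Finset.prod_Ioc_succ_top (by omega), Finset.prod_range_succ, ih]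

/-- **Gauss's identity** for the theta series. -/
theorem mul_rescale_thetaSeries {A B : ℤ⟦X⟧}
    (hA : HasProd (fun i : ℕ => 1 + (X : ℤ⟦X⟧) ^ (i + 1)) A)
    (hB : HasProd (fun i : ℕ => 1 - (X : ℤ⟦X⟧) ^ (i + 1)) B) :
    A * rescale (-1) thetaSeries = B := by
  have hG : Tendsto (fun n : ℕ => 1 + 2 * ∑ j ∈ Finset.range n,
      (-1) ^ (j + 1) * (X : ℤ⟦X⟧) ^ ((j + 1) ^ 2)) atTop (𝓝 (rescale (-1) thetaSeries)) := by
    rw [WithPiTopology.tendsto_iff_coeff_tendsto]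
    exact fun d => tendsto_atTop_of_eventually_const (i₀ := d)
      fun n hn => (coeff_rescale_thetaSeries hn).symm
  have hE : Tendsto (fun n : ℕ => 2 * ∑ s ∈ Finset.range n, (-1) ^ (s + 1) *
      (∏ i ∈ Finset.Ioc 0 s, (1 + (X : ℤ⟦X⟧) ^ i)) *
        (X ^ ((s + 1) * (n + 1)) * ∏ i ∈ Finset.Ioc (s + 1) n, (1 - X ^ i))) atTop (𝓝 0) := by
    rw [WithPiTopology.tendsto_iff_coeff_tendsto]
    refine fun d => tendsto_atTop_of_eventually_const (i₀ := d) fun n hn => ?_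
    rw [map_zero]
    refine (X_pow_dvd_iff (n := d + 1)).1 ?_ d (by omega)
    refine Dvd.dvd.mul_left (Finset.dvd_sum fun s _ => Dvd.dvd.mul_left (Dvd.dvd.mul_right
      (pow_dvd_pow _ ?_) _) _) _
    -- Every error term carries `X ^ ((s + 1) * (n + 1))`, of exponent above `n ≥ d`.
    nlinarith
  have h := (hA.tendsto_prod_nat.mul hG).congr fun n => by
    rw [← prod_Ioc_eq_prod_range (fun i => 1 + (X : ℤ⟦X⟧) ^ i), gauss_finite,
      prod_Ioc_eq_prod_range (fun i => 1 - (X : ℤ⟦X⟧) ^ i)]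
  simpa using tendsto_nhds_unique h (hB.tendsto_prod_nat.add hE)

/-! ### Product formulas for the generating functions -/

/-- The factor `1 + 2 ∑ X ^ (i * j) = (1 + X ^ i) / (1 - X ^ i)` of the overpartition generating
function. -/
noncomputable def overFactor (R : Type*) [CommRing R] (i : ℕ) : R⟦X⟧ :=
  PowerSeries.mk fun n => if n = 0 then 1 else if i ∣ n then 2 else 0

/-- Weights that mark the even parts of an overpartition by `z`. -/
def evenWeight {R : Type*} [CommRing R] (z : R) (i c : ℕ) : R :=
  2 * if Even i then z ^ (i * c) else 1

/-- The generating function of overpartitions with the sum of even parts marked by `z`. -/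
noncomputable def overSeries {R : Type*} [CommRing R] (z : R) : R⟦X⟧ :=
  Nat.Partition.genFun (evenWeight z)

section

variable {R : Type*} [CommRing R]

theorem overFactor_mul_one_sub {i : ℕ} (hi : 0 < i) :
    overFactor R i * (1 - X ^ i) = 1 + X ^ i := by
  ext n
  rw [mul_sub, mul_one, map_sub, coeff_mul_X_pow', map_add, coeff_one, coeff_X_pow]
  simp only [overFactor, coeff_mk]
  rcases lt_trichotomy n i with h | rfl | h
  · rw [if_neg (not_le.2 h), if_neg h.ne]
    split_ifs with h0 h1
    · simp
    · exact absurd (Nat.le_of_dvd (by omega) h1) (by omega)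
    · simp
  · simp [hi.ne']
    norm_num
  · have h1 : n ≠ 0 := by omega
    have h2 : n - i ≠ 0 := by omega
    simp [h1, h2, h.le, h.ne', Nat.dvd_sub_iff_left h.le dvd_rfl]

/-- For odd `i`, the substitution `X ↦ -X` swaps `1 + X ^ i` and `1 - X ^ i`. -/
theorem rescale_neg_one_overFactor {i : ℕ} (hi : Odd i) :
    overFactor R i * rescale (-1) (overFactor R i) = 1 := by
  have h := overFactor_mul_one_sub (R := R) hi.pos
  have h' := congrArg (rescale (-1 : R)) h
  simp only [map_mul, map_sub, map_add, map_one, map_pow, rescale_neg_one_X, hi.neg_pow] at h'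
  have hu : IsUnit (1 + X ^ i : R⟦X⟧) := by
    rw [isUnit_iff_constantCoeff]
    simp [hi.pos.ne']
  have hv : IsUnit (1 - X ^ i : R⟦X⟧) := by
    rw [isUnit_iff_constantCoeff]
    simp [hi.pos.ne']
  refine (hu.mul hv).mul_left_cancel ?_
  linear_combination (1 + X ^ i) * rescale (-1) (overFactor R i) * h + (1 + X ^ i) * h'

theorem expand_overFactor (i : ℕ) :
    expand 2 two_ne_zero (overFactor R i) = overFactor R (2 * i) := by
  ext n
  rw [coeff_expand]
  split_ifs with h
  · obtain ⟨m, rfl⟩ := h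
    simp [overFactor, Nat.mul_dvd_mul_iff_left]
  · have h0 : n ≠ 0 := by rintro rfl; simp at h
    have h1 : ¬ 2 * i ∣ n := fun h' => h (dvd_of_mul_right_dvd h')
    simp [overFactor, h0, h1]

theorem map_overSeries {S : Type*} [CommRing S] (φ : R →+* S) (z : R) :
    PowerSeries.map φ (overSeries z) = overSeries (φ z) := by
  ext n
  simp [overSeries, Finsupp.prod, evenWeight, apply_ite φ, map_ofNat]

theorem rescale_zero_overFactor (i : ℕ) : rescale 0 (overFactor R i) = 1 := by
  simp [overFactor]

variable [TopologicalSpace R]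

theorem continuous_rescale [DiscreteTopology R] (a : R) :
    Continuous (rescale a : R⟦X⟧ →+* R⟦X⟧) := by
  refine continuous_iff_continuousAt.2 fun f => ?_
  rw [ContinuousAt, WithPiTopology.tendsto_iff_coeff_tendsto]
  intro d
  simp only [coeff_rescale]
  exact ((continuous_of_discreteTopology (f := fun x : R => a ^ d * x)).comp
    (WithPiTopology.continuous_coeff R d)).continuousAt

theorem continuous_expand {p : ℕ} (hp : p ≠ 0) : Continuous (expand p hp : R⟦X⟧ →ₐ[R] R⟦X⟧) := by
  refine continuous_iff_continuousAt.2 fun f => ?_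
  rw [ContinuousAt, WithPiTopology.tendsto_iff_coeff_tendsto]
  intro d
  simp only [coeff_expand]
  split_ifs
  · exact (WithPiTopology.continuous_coeff R _).continuousAt
  · exact tendsto_const_nhds

theorem one_add_tsum_evenWeight [T2Space R] (z : R) (i : ℕ) :
    (1 + ∑' j, evenWeight z (i + 1) (j + 1) • (X : R⟦X⟧) ^ ((i + 1) * (j + 1))) =
      if Even (i + 1) then rescale z (overFactor R (i + 1)) else overFactor R (i + 1) := by
  have hs : HasSum (fun j => evenWeight z (i + 1) (j + 1) • (X : R⟦X⟧) ^ ((i + 1) * (j + 1)))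
      ((if Even (i + 1) then rescale z (overFactor R (i + 1)) else overFactor R (i + 1)) - 1) := by
    rw [WithPiTopology.hasSum_iff_hasSum_coeff]
    intro d
    by_cases hd : d ≠ 0 ∧ i + 1 ∣ d
    · obtain ⟨hd, j, rfl⟩ := hd
      obtain ⟨j, rfl⟩ := Nat.exists_eq_add_one_of_ne_zero (by rintro rfl; simp at hd : j ≠ 0)
      convert hasSum_single j ?_ using 1
      · split_ifs with h <;> simp [overFactor, coeff_one, coeff_X_pow, evenWeight, h, mul_comm]
      · intro k hk
        simp [coeff_X_pow, hk.symm]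
    · convert hasSum_zero with j
      · simp only [coeff_smul, coeff_X_pow]
        rw [if_neg, smul_zero]
        rintro rfl
        exact hd ⟨by positivity, dvd_mul_right _ _⟩
      · rw [not_and] at hd
        by_cases h0 : d = 0
        · subst h0
          split_ifs <;> simp [overFactor, -coeff_zero_eq_constantCoeff]
        · split_ifs <;> simp [overFactor, coeff_one, h0, hd h0]
  rw [hs.tsum_eq]
  ring

theorem hasProd_overSeries [T2Space R] (z : R) :
    HasProd (fun i => if Even (i + 1) then rescale z (overFactor R (i + 1))
      else overFactor R (i + 1)) (overSeries z) := by
  have h := Nat.Partition.hasProd_genFun (evenWeight z)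
  simp only [one_add_tsum_evenWeight] at h
  exact h

theorem hasProd_overSeries_one [T2Space R] :
    HasProd (fun i => overFactor R (i + 1)) (overSeries (1 : R)) := by
  simpa using hasProd_overSeries (1 : R)

theorem hasProd_overSeries_zero [T2Space R] :
    HasProd (fun k => overFactor R (2 * k + 1)) (overSeries (0 : R)) := by
  have h := hasProd_overSeries (0 : R)
  rw [← (mul_right_injective₀ (two_ne_zero (α := ℕ))).hasProd_iff] at h
  · convert h using 2 with k
    simp
  · intro i hi
    have : ¬ Even i := fun ⟨k, hk⟩ => hi ⟨k, by simp; omega⟩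
    rw [if_pos (by grind), rescale_zero_overFactor]

end

section

variable {R : Type*} [CommRing R]

/-- Odd parts do not see `z`, and setting `z = 0` isolates them. Even parts are doubled arbitrary
parts, and `z` records their total size, so marking them is a rescaling of `X`. -/
theorem overSeries_eq_mul (z : R) :
    overSeries z = overSeries 0 * rescale z (expand 2 two_ne_zero (overSeries 1)) := by
  -- The discrete topology serves only to give meaning to the infinite products.
  let _ : TopologicalSpace R := ⊥
  have : DiscreteTopology R := ⟨rfl⟩
  have h := ((hasProd_overSeries_one (R := R)).map (expand 2 two_ne_zero)
    (continuous_expand two_ne_zero)).map (rescale z) (continuous_rescale z)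
  refine (hasProd_overSeries z).unique (HasProd.even_mul_odd ?_ ?_)
  · convert hasProd_overSeries_zero (R := R) using 2 with k
    simp
  · convert h using 2 with k
    rw [if_pos (by grind)]
    simp [expand_overFactor, mul_add]

theorem overSeries_zero_mul_rescale :
    overSeries (0 : R) * rescale (-1) (overSeries 0) = 1 := by
  let _ : TopologicalSpace R := ⊥
  have : DiscreteTopology R := ⟨rfl⟩
  have h := hasProd_overSeries_zero (R := R)
  refine (h.mul (h.map (rescale (-1)) (continuous_rescale _))).unique ?_
  convert hasProd_one with k
  exact rescale_neg_one_overFactor (by simp)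

end

/-! ### Part sums as coefficients -/

theorem prod_evenWeight {R : Type*} [CommRing R] (z : R) (s : Multiset ℕ) :
    s.toFinsupp.prod (evenWeight z) = 2 ^ s.toFinset.card * z ^ (s.filter Even).sum := by
  have h : (s.filter Even).sum = ∑ i ∈ s.toFinset, if Even i then i * s.count i else 0 := by
    rw [Finset.sum_multiset_count, Multiset.toFinset_filter, Finset.sum_filter]
    refine Finset.sum_congr rfl fun i _ => ?_
    split_ifs with hi
    · simp [Multiset.count_filter_of_pos hi, mul_comm]
    · rfl
  rw [h, ← Finset.prod_pow_eq_pow_sum, ← Finset.prod_const, ← Finset.prod_mul_distrib,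
    Finsupp.prod, Multiset.toFinsupp_support]
  refine Finset.prod_congr rfl fun i _ => ?_
  rw [evenWeight, Multiset.toFinsupp_apply]
  split_ifs <;> simp

theorem Overpartition.sum_toPartition {M : Type*} [AddCommMonoid M] {n : ℕ}
    (g : n.Partition → M) :
    ∑ a : Overpartition n, g a.toPartition = ∑ p, 2 ^ p.parts.toFinset.card • g p := by
  rw [Fintype.sum_equiv (Overpartition.equivSigma n) (fun a => g a.toPartition) (fun x => g x.1) (fun _ => rfl),
    Fintype.sum_sigma]
  refine Finset.sum_congr rfl fun p _ => ?_
  simp only [Finset.sum_const]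
  rw [Finset.card_univ, Fintype.card_coe, Finset.card_powerset]

theorem Overpartition.natCast_card (n : ℕ) :
    (Fintype.card (Overpartition n) : ℤ) = coeff n (overSeries (1 : ℤ)) := by
  rw [Fintype.card_eq_sum_ones, Overpartition.sum_toPartition (fun _ => 1), overSeries,
    Nat.Partition.coeff_genFun]
  simp [prod_evenWeight]

theorem Overpartition.natCast_evenPartsSum_eq_eval (n : ℕ) :
    (Overpartition.evenPartsSum n : ℤ) =
      (coeff n (overSeries (Polynomial.X : Polynomial ℤ))).derivative.eval 1 := by
  rw [evenPartsSum]
  simp only [parts]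
  rw [Overpartition.sum_toPartition (fun p => (p.parts.filter Even).sum), overSeries,
    Nat.Partition.coeff_genFun]
  simp only [prod_evenWeight, Polynomial.derivative_sum, Polynomial.eval_finsetSum]
  push_cast
  refine Finset.sum_congr rfl fun p _ => ?_
  rw [show (2 : Polynomial ℤ) = Polynomial.C 2 by simp, ← Polynomial.C_pow,
    Polynomial.derivative_C_mul, Polynomial.derivative_X_pow]
  simp only [Polynomial.eval_mul, Polynomial.eval_C, Polynomial.eval_pow, Polynomial.eval_X,
    one_pow, mul_one, nsmul_eq_mul]
  push_cast
  ring

/-- In `overSeries_eq_mul` only the rescaled factor depends on `z`; differentiating `z ^ b` at `1`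
yields the weight `b`. -/
theorem Overpartition.natCast_evenPartsSum (n : ℕ) :
    (Overpartition.evenPartsSum n : ℤ) = ∑ x ∈ Finset.HasAntidiagonal.antidiagonal n,
      coeff x.1 (overSeries (0 : ℤ)) *
        (x.2 * coeff x.2 (expand 2 two_ne_zero (overSeries (1 : ℤ)))) := by
  rw [natCast_evenPartsSum_eq_eval, overSeries_eq_mul]
  have h0 : overSeries (0 : Polynomial ℤ) = PowerSeries.map Polynomial.C (overSeries 0) := by
    simp [map_overSeries]
  have h1 : overSeries (1 : Polynomial ℤ) = PowerSeries.map Polynomial.C (overSeries 1) := by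
    simp [map_overSeries]
  rw [h0, h1, coeff_mul, Polynomial.derivative_sum, Polynomial.eval_finsetSum]
  refine Finset.sum_congr rfl fun x _ => ?_
  rw [← map_expand, coeff_rescale, coeff_map, coeff_map, Polynomial.derivative_C_mul,
    Polynomial.derivative_mul]
  simp [Polynomial.derivative_X_pow]

theorem Overpartition.oddPartsSum_add_evenPartsSum (n : ℕ) :
    oddPartsSum n + evenPartsSum n = n * Fintype.card (Overpartition n) := by
  rw [oddPartsSum, evenPartsSum, ← Finset.sum_add_distrib, Fintype.card, Finset.card_eq_sum_ones,
    Finset.mul_sum]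
  refine Finset.sum_congr rfl fun a _ => ?_
  have : a.parts.filter Odd = a.parts.filter fun i => ¬ Even i := by simp
  rw [this, ← Multiset.sum_add, add_comm, Multiset.filter_add_not, parts,
    a.toPartition.parts_sum, mul_one]

/-! ### Factorisations through the theta series -/

theorem overSeries_one_eq :
    overSeries (1 : ℤ) = overSeries 0 * expand 2 two_ne_zero (overSeries 1) := by
  simpa using overSeries_eq_mul (1 : ℤ)

theorem overSeries_one_mul_rescale_thetaSeries :
    overSeries (1 : ℤ) * rescale (-1) thetaSeries = 1 := by
  have hB := (WithPiTopology.multipliable_one_sub_X_pow ℤ).hasProd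
  -- By the factor identity, `∏ (1 + X ^ i)` is `P · ∏ (1 - X ^ i)`; the latter product then cancels
  -- in Gauss's identity.
  have hA : HasProd (fun i : ℕ => 1 + (X : ℤ⟦X⟧) ^ (i + 1))
      (overSeries 1 * ∏' i : ℕ, (1 - (X : ℤ⟦X⟧) ^ (i + 1))) := by
    convert hasProd_overSeries_one.mul hB using 2 with i
    rw [overFactor_mul_one_sub (Nat.succ_pos i)]
  have h := mul_rescale_thetaSeries hA hB
  refine mul_left_cancel₀ (WithPiTopology.tprod_one_sub_X_pow_ne_zero ℤ) ?_
  linear_combination h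

theorem rescale_neg_one_expand_two (f : ℤ⟦X⟧) :
    rescale (-1) (expand 2 two_ne_zero f) = expand 2 two_ne_zero f := by
  ext n
  rw [coeff_rescale, coeff_expand]
  split_ifs with h
  · rw [(even_iff_two_dvd.2 h).neg_one_pow, one_mul]
  · simp

/-- Splitting the overpartition generating function into theta series and a square in `X ^ 2`. -/
theorem overSeries_one_eq_thetaSeries_mul :
    overSeries (1 : ℤ) = thetaSeries * expand 2 two_ne_zero (overSeries 1) ^ 2 := by
  have h1 := overSeries_one_eq
  have h2 := congrArg (rescale (-1 : ℤ)) h1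
  rw [map_mul, rescale_neg_one_expand_two] at h2
  have h3 := overSeries_zero_mul_rescale (R := ℤ)
  have h4 := congrArg (rescale (-1 : ℤ)) overSeries_one_mul_rescale_thetaSeries
  rw [map_mul, rescale_rescale] at h4
  simp only [mul_neg, mul_one, neg_neg, rescale_one, RingHom.id_apply, map_one] at h4
  set P := overSeries (1 : ℤ)
  set O := overSeries (0 : ℤ)
  set E := expand 2 two_ne_zero P
  have h5 : P * rescale (-1) P = E ^ 2 := by
    rw [h2]
    linear_combination (rescale (-1) O * E) * h1 + E ^ 2 * h3
  linear_combination (-P) * h4 + thetaSeries * h5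

theorem overSeries_zero_eq_thetaSeries_mul :
    overSeries (0 : ℤ) = thetaSeries * expand 2 two_ne_zero (overSeries 1) := by
  have h : overSeries (1 : ℤ) ≠ 0 := by
    intro h
    simpa [h] using overSeries_one_mul_rescale_thetaSeries
  have hE : expand 2 two_ne_zero (overSeries (1 : ℤ)) ≠ 0 := by
    intro h'
    exact h (by rw [overSeries_one_eq, h', mul_zero])
  refine mul_right_cancel₀ hE ?_
  linear_combination overSeries_one_eq_thetaSeries_mul - overSeries_one_eq

theorem X_mul_derivative_coeff {R : Type*} [CommRing R] (f : R⟦X⟧) (n : ℕ) :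
    coeff n (X * d⁄dX R f) = n * coeff n f := by
  cases n with
  | zero => simp
  | succ n => rw [coeff_succ_X_mul, coeff_derivative]; push_cast; ring

/-- With `E = P(q²)`, `2 O θE = φ · 2 E θE = φ · θ(E²)`. -/
theorem Overpartition.two_mul_evenPartsSum (n : ℕ) :
    2 * (Overpartition.evenPartsSum n : ℤ) = ∑ x ∈ Finset.HasAntidiagonal.antidiagonal n,
      coeff x.1 thetaSeries * (x.2 * coeff x.2 (expand 2 two_ne_zero (overSeries (1 : ℤ) ^ 2))) := by
  rw [natCast_evenPartsSum]
  simp only [← X_mul_derivative_coeff, ← coeff_mul]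
  rw [overSeries_zero_eq_thetaSeries_mul, map_pow, derivative_pow,
    show (2 : ℤ) = ((2 : ℕ) : ℤ) by rfl, ← nsmul_eq_mul, ← map_nsmul]
  congr 1
  simp
  ring

/-! ### Divisibility by powers of 2 -/

theorem coeff_thetaSeries_of_odd {n : ℕ} (hn : Odd n) (h : coeff n thetaSeries ≠ 0) :
    coeff n thetaSeries = 2 ∧ n % 8 = 1 := by
  rw [thetaSeries, coeff_mk] at h ⊢
  rw [if_neg hn.pos.ne'] at h ⊢
  split_ifs at h ⊢ with hs
  · obtain ⟨k, rfl⟩ := hs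
    refine ⟨rfl, ?_⟩
    have hk : k % 2 = 1 := by
      rw [Nat.odd_mul] at hn
      exact Nat.odd_iff.1 hn.1
    have : k % 8 = 1 ∨ k % 8 = 3 ∨ k % 8 = 5 ∨ k % 8 = 7 := by omega
    rcases this with h | h | h | h <;> simp [Nat.mul_mod, h]
  · exact absurd rfl h

theorem coeff_thetaSeries_sq_eq_zero {n : ℕ} (hn : n % 4 = 3) : coeff n (thetaSeries ^ 2) = 0 := by
  have key (k : ℕ) (h : coeff k thetaSeries ≠ 0) : k % 4 = 0 ∨ k % 4 = 1 := by
    have hs : IsSquare k := by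
      rw [thetaSeries, coeff_mk] at h
      by_contra hs
      have h0 : k ≠ 0 := by rintro rfl; simp at hs
      simp [h0, hs] at h
    obtain ⟨m, rfl⟩ := hs
    have : m % 4 = 0 ∨ m % 4 = 1 ∨ m % 4 = 2 ∨ m % 4 = 3 := by omega
    rcases this with h | h | h | h <;> simp [Nat.mul_mod, h]
  rw [pow_two, coeff_mul]
  refine Finset.sum_eq_zero fun x hx => ?_
  rw [Finset.HasAntidiagonal.mem_antidiagonal] at hx
  by_contra h
  have h1 := key _ (left_ne_zero_of_mul h)
  have h2 := key _ (right_ne_zero_of_mul h)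
  omega

theorem exists_thetaSeries_eq : ∃ t : ℤ⟦X⟧, thetaSeries = 1 + 2 * t := by
  refine ⟨PowerSeries.mk fun n => if n = 0 then 0 else if IsSquare n then 1 else 0, ?_⟩
  ext n
  rw [show (2 : ℤ⟦X⟧) = C 2 by simp, map_add, coeff_C_mul, coeff_one, thetaSeries, coeff_mk,
    coeff_mk]
  split_ifs <;> simp

theorem exists_overSeries_eq : ∃ t : ℤ⟦X⟧, overSeries 1 = 1 + 2 * t := by
  obtain ⟨t, ht⟩ := exists_thetaSeries_eq
  have h := overSeries_one_mul_rescale_thetaSeries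
  rw [ht, map_add, map_one, map_mul, map_ofNat] at h
  exact ⟨-(overSeries 1 * rescale (-1) t), by linear_combination h⟩

theorem dvd_coeff_of_eq {f g : ℤ⟦X⟧} {c : ℤ} (h : f = 1 + C c * g) {n : ℕ} (hn : n ≠ 0) :
    c ∣ coeff n f := by
  rw [h, map_add, coeff_one, if_neg hn, zero_add, coeff_C_mul]
  exact dvd_mul_right _ _

theorem four_dvd_coeff_thetaSeries_sq {n : ℕ} (hn : n ≠ 0) : 4 ∣ coeff n (thetaSeries ^ 2) := by
  obtain ⟨t, ht⟩ := exists_thetaSeries_eq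
  exact dvd_coeff_of_eq (g := t + t ^ 2) (by rw [ht, map_ofNat]; ring) hn

theorem four_dvd_coeff_overSeries_sq {n : ℕ} (hn : n ≠ 0) :
    4 ∣ coeff n (overSeries (1 : ℤ) ^ 2) := by
  obtain ⟨t, ht⟩ := exists_overSeries_eq
  exact dvd_coeff_of_eq (g := t + t ^ 2) (by rw [ht, map_ofNat]; ring) hn

theorem eight_dvd_coeff_overSeries_pow_four {n : ℕ} (hn : n ≠ 0) :
    8 ∣ coeff n (overSeries (1 : ℤ) ^ 4) := by
  obtain ⟨t, ht⟩ := exists_overSeries_eq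
  exact dvd_coeff_of_eq (g := t + 3 * t ^ 2 + 4 * t ^ 3 + 2 * t ^ 4)
    (by rw [ht, map_ofNat]; ring) hn

/-- Squaring the factorisation gives `P² = φ² · P(q²)⁴`. Terms with `b = 0` vanish because `n` is
not a sum of two squares; the others contribute `4 · 8`. -/
theorem dvd_coeff_overSeries_sq {n : ℕ} (hn : n % 4 = 3) :
    32 ∣ coeff n (overSeries (1 : ℤ) ^ 2) := by
  have h : overSeries (1 : ℤ) ^ 2 =
      thetaSeries ^ 2 * expand 2 two_ne_zero (overSeries 1 ^ 4) := by
    rw [map_pow]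
    linear_combination (overSeries (1 : ℤ) + thetaSeries * expand 2 two_ne_zero (overSeries 1) ^ 2) *
      overSeries_one_eq_thetaSeries_mul
  rw [h, coeff_mul]
  refine Finset.dvd_sum fun x hx => ?_
  rw [Finset.HasAntidiagonal.mem_antidiagonal] at hx
  rw [coeff_expand]
  split_ifs with h2
  · by_cases h0 : x.2 = 0
    · rw [coeff_thetaSeries_sq_eq_zero (by omega), zero_mul]
      exact dvd_zero _
    · exact mul_dvd_mul (a := (4 : ℤ)) (c := 8) (four_dvd_coeff_thetaSeries_sq (by omega))
        (eight_dvd_coeff_overSeries_pow_four (by omega))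
  · simp

/-- A nonzero term has `b` even, so `a` is an odd square: its theta coefficient is `2` and `a ≡ 1`
mod 8. Hence `b / 2` is odd, and `≡ 3` mod 4 when `n ≡ 7` mod 8, giving `2 · 4` and `2 · 32`. -/
theorem dvd_coeff_thetaSeries_mul {n a b : ℕ} (hab : a + b = n) (hn : n % 4 = 3) :
    8 ∣ coeff a thetaSeries * coeff b (expand 2 two_ne_zero (overSeries (1 : ℤ) ^ 2)) ∧
    (n % 8 = 7 → 64 ∣ coeff a thetaSeries *
      coeff b (expand 2 two_ne_zero (overSeries (1 : ℤ) ^ 2))) := by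
  rw [coeff_expand]
  by_cases h2 : 2 ∣ b
  · rw [if_pos h2]
    by_cases ha : coeff a thetaSeries = 0
    · simp [ha]
    obtain ⟨h, ha'⟩ := coeff_thetaSeries_of_odd (Nat.odd_iff.2 (by omega)) ha
    rw [h]
    exact ⟨mul_dvd_mul (a := (2 : ℤ)) (c := 4) dvd_rfl (four_dvd_coeff_overSeries_sq (by omega)),
      fun hn' => mul_dvd_mul (a := (2 : ℤ)) (c := 32) dvd_rfl
        (dvd_coeff_overSeries_sq (by omega))⟩
  · simp [h2]

theorem Overpartition.dvd_card {n : ℕ} {c : ℤ}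
    (h : ∀ a b, a + b = n →
      c ∣ coeff a thetaSeries * coeff b (expand 2 two_ne_zero (overSeries (1 : ℤ) ^ 2))) :
    c ∣ Fintype.card (Overpartition n) := by
  rw [natCast_card, overSeries_one_eq_thetaSeries_mul, ← map_pow, coeff_mul]
  exact Finset.dvd_sum fun x hx => h _ _ (Finset.HasAntidiagonal.mem_antidiagonal.1 hx)

theorem Overpartition.dvd_evenPartsSum {n : ℕ} {c : ℤ}
    (h : ∀ a b, a + b = n →
      c ∣ coeff a thetaSeries * coeff b (expand 2 two_ne_zero (overSeries (1 : ℤ) ^ 2))) :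
    c ∣ evenPartsSum n := by
  refine Int.dvd_of_mul_dvd_mul_left (a := 2) (by norm_num) ?_
  rw [two_mul_evenPartsSum]
  refine Finset.dvd_sum fun x hx => ?_
  -- The weight `b` is even in every nonzero term, which pays for the factor 2 on the left.
  by_cases h2 : 2 ∣ x.2
  · have := mul_dvd_mul (Int.natCast_dvd_natCast.2 h2) (h _ _ (Finset.HasAntidiagonal.mem_antidiagonal.1 hx))
    rw [mul_left_comm]
    exact_mod_cast this
  · rw [coeff_expand, if_neg h2]
    simp

theorem Overpartition.partsSum_modEq_zero {n c : ℕ}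
    (h : ∀ a b, a + b = n →
      (c : ℤ) ∣ coeff a thetaSeries * coeff b (expand 2 two_ne_zero (overSeries (1 : ℤ) ^ 2))) :
    oddPartsSum n ≡ 0 [MOD c] ∧ evenPartsSum n ≡ 0 [MOD c] := by
  have he : c ∣ evenPartsSum n := Int.natCast_dvd_natCast.1 (dvd_evenPartsSum h)
  have hs : c ∣ oddPartsSum n + evenPartsSum n := by
    rw [oddPartsSum_add_evenPartsSum]
    exact (Int.natCast_dvd_natCast.1 (dvd_card h)).mul_left n
  exact ⟨Nat.modEq_zero_iff_dvd.2 ((Nat.dvd_add_left he).1 hs), Nat.modEq_zero_iff_dvd.2 he⟩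

theorem mainTheorem6 (n : ℕ) :
    (Overpartition.oddPartsSum (4 * n + 3) ≡ 0 [MOD 8] ∧
      Overpartition.evenPartsSum (4 * n + 3) ≡ 0 [MOD 8]) ∧
    (Overpartition.oddPartsSum (8 * n + 7) ≡ 0 [MOD 64] ∧
      Overpartition.evenPartsSum (8 * n + 7) ≡ 0 [MOD 64]) :=
  ⟨Overpartition.partsSum_modEq_zero fun _ _ h => (dvd_coeff_thetaSeries_mul h (by omega)).1,
    Overpartition.partsSum_modEq_zero fun _ _ h =>
      (dvd_coeff_thetaSeries_mul h (by omega)).2 (by omega)⟩
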